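/- Throughout, $\log=\log_2$, all Hilbert spaces are finite-dimensional, $\|A\|_{\mathrm{tr}}=\operatorname{tr}\sqrt{A^\dagger A}$, and $\rho_{U_m}$ is the fully mixed state of dimension $2^m$. Random variables are identified with diagonal density operators. The min-entropy of a random variable $X$ is $H_{\min}(X)=-\log\max_x\Pr[X=x]$, and the conditional min-entropy of a sub-normalized state $\rho_{XE}$ (positive semi-definite, trace at most $1$) is $$H_{\min}(X|E)_\rho=\max_{\sigma_E}\{\lambda\in\mathbb R: 2^{-\lambda}\,\mathbb 1_X\otimes\sigma_E\ge\rho_{XE}\},$$ the maximum being over density operators $\sigma_E\ge 0$ with $\operatorname{tr}\sigma_E=1$ (and it is $+\infty$ if $\rho_{XE}=0$). A function $\mathrm{Ext}:\{0,1\}^n\times\{0,1\}^d\to\{0,1\}^m$ is a $(k,\varepsilon)$-strong extractor with an $s$-bit seed if, for every random variable $X$ with $H_{\min}(X)\ge k$ and every seed $Y$ independent of $X$ with $H_{\min}(Y)\ge s$, $$\tfrac12\|\rho_{\mathrm{Ext}(X,Y)Y}-\rho_{U_m}\otimes\rho_Y\|_{\mathrm{tr}}\le\varepsilon.$$ It is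 a quantum-proof $(k,\varepsilon)$-strong extractor with an $s$-bit seed if, for every (normalized or sub-normalized) state $\rho_{XE}=\sum_{x}|x\rangle\langle x|\otimes\rho_x$ classical on $X$ with $H_{\min}(X|E)_\rho\ge k$ and every seed $Y$ independent of $XE$ with $H_{\min}(Y)\ge s$, $$\tfrac12\|\rho_{\mathrm{Ext}(X,Y)YE}-\rho_{U_m}\otimes\rho_Y\otimes\rho_E\|_{\mathrm{tr}}\le\varepsilon.$$ Sets $S_1,\dots,S_m\subseteq\{1,\dots,d\}$ form a weak $(t,r)$-design if, for all $i$, $|S_i|=t$ and $\sum_{j<i}2^{|S_j\cap S_i|}\le rm$. **Theorem.** Let $k,s,r\in\mathbb R$ and $\varepsilon>0$, let $C:\{0,1\}^n\times\{0,1\}^t\to\{0,1\}$ be a $(k,\varepsilon)$-strong extractor with an $s$-bit seed, and let $S_1,\dots,S_m\subseteq\{1,\dots,d\}$ be a weak $(t,r)$-design. Then $$\mathrm{Ext}_C:\{0,1\}^n\times\{0,1\}^d\to\{0,1\}^m,\qquad \mathrm{Ext}_C(x,y)=C(x,y_{S_1})\cdots C(x,y_{S_m}),$$ where $y_S$ is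 the string of the bits of $y$ at the positions in $S$, is a quantum-proof $\left(k+rm+\log\frac1\varepsilon,\;6m\sqrt\varepsilon\right)$-strong extractor with a $\left(d-\left(t-s-\log\frac{1}{3\sqrt\varepsilon}\right)\right)$-bit seed. -/

import Mathlib

open scoped Kronecker ComplexOrder

namespace QExtractor

noncomputable section

/-- Bit strings of length `n`. -/
abbrev BitString (n : ℕ) : Type := Fin n → Bool

/-- The trace norm `tr √(Aᴴ A)`. -/
def traceNorm {a : Type} [Fintype a] [DecidableEq a] (A : Matrix a a ℂ) : ℝ :=
  (cfc Real.sqrt (A.conjTranspose * A)).trace.re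

/-- Normalized quantum states: positive semi-definite with trace one. -/
def IsState {a : Type} [Fintype a] (ρ : Matrix a a ℂ) : Prop :=
  ρ.PosSemidef ∧ ρ.trace = 1

/-- Sub-normalized quantum states: positive semi-definite with trace at most one. -/
def IsSubState {a : Type} [Fintype a] (ρ : Matrix a a ℂ) : Prop :=
  ρ.PosSemidef ∧ ρ.trace.re ≤ 1

/-- The rank-one projector `|x⟩⟨x|` onto a vector of the computational basis. -/
def proj {X : Type} [DecidableEq X] (x : X) : Matrix X X ℂ :=
  Matrix.single x x 1

/-- The diagonal state `∑ x, p x |x⟩⟨x|` of a random variable with distribution `p`. -/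
def classicalState {X : Type} [Fintype X] [DecidableEq X] (p : X → ℝ) : Matrix X X ℂ :=
  ∑ x, p x • proj x

/-- The fully mixed state on a system whose computational basis is indexed by `Z`. -/
def mixedState (Z : Type) [Fintype Z] [DecidableEq Z] : Matrix Z Z ℂ :=
  ((Fintype.card Z : ℝ)⁻¹) • (1 : Matrix Z Z ℂ)

/-- The state `∑ x, |x⟩⟨x| ⊗ ρ x`, classical on `X`. The operators `ρ x` on `E` are not normalized:
`ρ x` is the conditional state of `E` given `X = x`, multiplied by the probability of `x`. -/
def cqState {X E : Type} [Fintype X] [DecidableEq X] (ρ : X → Matrix E E ℂ) :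
    Matrix (X × E) (X × E) ℂ :=
  ∑ x, proj x ⊗ₖ ρ x

/-- The partial trace over the first system. -/
def partialTraceLeft {A B : Type} [Fintype A] (ρ : Matrix (A × B) (A × B) ℂ) : Matrix B B ℂ :=
  fun b b' => ∑ a, ρ (a, b) (a, b')

/-- The min-entropy of `A` conditioned on `B` of a state `ρ` of `A ⊗ B`: the largest `lam` with
`2 ^ (-lam) • 1 ⊗ σ ≥ ρ` for some normalized state `σ` of `B`. It takes values in the extended
reals only because it is infinite for `ρ = 0`. -/
def condMinEntropy {A B : Type} [Fintype A] [DecidableEq A] [Fintype B]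
    (ρ : Matrix (A × B) (A × B) ℂ) : EReal :=
  sSup {l : EReal | ∃ lam : ℝ, l = (lam : EReal) ∧ ∃ σ : Matrix B B ℂ, IsState σ ∧
    (((2 : ℝ) ^ (-lam)) • ((1 : Matrix A A ℂ) ⊗ₖ σ) - ρ).PosSemidef}

/-- The min-entropy `-log₂ (max_x p x)` of a probability distribution on a finite set. -/
def minEntropy {X : Type} (p : X → ℝ) : ℝ :=
  -Real.logb 2 (⨆ x, p x)

/-- The state of `Ext(X,Y) Y`, for independent `X` and `Y` with distributions `p` and `q`. -/
def outputSeedState {X Y Z : Type} [Fintype X] [Fintype Y] [DecidableEq Y] [DecidableEq Z]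
    (Ext : X → Y → Z) (p : X → ℝ) (q : Y → ℝ) : Matrix (Z × Y) (Z × Y) ℂ :=
  ∑ x, ∑ y, (p x * q y) • (proj (Ext x y) ⊗ₖ proj y)

/-- The state of `Ext(X,Y) Y E`, where `XE` is in the state `cqState ρ` and the seed `Y`, with
distribution `q`, is independent of `XE`. -/
def outputSeedSideState {X Y Z E : Type} [Fintype X] [Fintype Y] [DecidableEq Y] [DecidableEq Z]
    (Ext : X → Y → Z) (ρ : X → Matrix E E ℂ) (q : Y → ℝ) :
    Matrix (Z × Y × E) (Z × Y × E) ℂ :=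
  ∑ x, ∑ y, q y • (proj (Ext x y) ⊗ₖ (proj y ⊗ₖ ρ x))

/-- `(k, ε)`-strong extractors with an `s`-bit seed, i.e. a seed of min-entropy at least `s`.
The output set `Z` is `Bool` for one-bit extractors and `BitString m` for `m`-bit extractors. -/
def IsStrongExtractor {n d : ℕ} {Z : Type} [Fintype Z] [DecidableEq Z]
    (Ext : BitString n → BitString d → Z) (k ε s : ℝ) : Prop :=
  ∀ p ∈ stdSimplex ℝ (BitString n), k ≤ minEntropy p →
    ∀ q ∈ stdSimplex ℝ (BitString d), s ≤ minEntropy q →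
      1 / 2 * traceNorm (outputSeedState Ext p q - mixedState Z ⊗ₖ classicalState q) ≤ ε

/-- Quantum-proof `(k, ε)`-strong extractors with an `s`-bit seed. Here `E` indexes an orthonormal
basis of the (arbitrary, finite-dimensional) space of the side information. -/
def IsQuantumProofStrongExtractor {n d : ℕ} {Z : Type} [Fintype Z] [DecidableEq Z]
    (Ext : BitString n → BitString d → Z) (k ε s : ℝ) : Prop :=
  ∀ (E : Type) [Fintype E] [DecidableEq E] (ρ : BitString n → Matrix E E ℂ),
    IsSubState (cqState ρ) → (k : EReal) ≤ condMinEntropy (cqState ρ) →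
    ∀ q ∈ stdSimplex ℝ (BitString d), s ≤ minEntropy q →
      1 / 2 * traceNorm (outputSeedSideState Ext ρ q -
        mixedState Z ⊗ₖ (classicalState q ⊗ₖ partialTraceLeft (cqState ρ))) ≤ ε

/-- Weak `(t, r)`-designs. -/
structure IsWeakDesign {m d : ℕ} (S : Fin m → Finset (Fin d)) (t : ℕ) (r : ℝ) : Prop where
  card_eq : ∀ i, (S i).card = t
  sum_le : ∀ i, ∑ j ∈ Finset.univ.filter (fun j => j < i), (2 : ℝ) ^ (S j ∩ S i).card ≤ r * m

/-- The string `y_S` of the bits of `y` at the positions in `S`, in increasing order. -/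
def substring {d t : ℕ} (y : BitString d) (S : Finset (Fin d)) (hS : S.card = t) : BitString t :=
  fun j => y (S.orderEmbOfFin hS j)

/-- Trevisan's extractor: the `i`-th output bit is `C(x, y_{S_i})`. -/
def trevisan {n t d m : ℕ} (C : BitString n → BitString t → Bool) (S : Fin m → Finset (Fin d))
    (hS : ∀ i, (S i).card = t) : BitString n → BitString d → BitString m :=
  fun x y i => C x (substring y (S i) (hS i))

end

end QExtractor

/-! This is Trevisan's reconstruction argument, with a pretty good measurement handling the quantum
side information. Output and seed are classical, so the distance is at most a seed average of sums
of trace norms. The hybrid argument (`sum_traceNorm_sub_le`) bounds these by the biases of single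
output bits, given E and the earlier bits. Once the seed bits outside `S i` are fixed, each earlier
bit depends on x and on the seed bits shared with `S i` only, so truth tables determined by x
reproduce it. The weak design leaves at most 2^(rm) tuples of tables (`card_truthTables_le`), which
costs rm bits of min-entropy.

What remains is `C` against E together with a classical register g (`sum_traceNorm_bias_le`). With τ
the signed sum of the ρ_x in one fibre and ω their unsigned sum, slightly regularized, Hölder gives
‖τ‖² ≤ tr ω · tr(τ ω^(-1/2) τ ω^(-1/2)). Expanding one τ bounds the last trace by the bias of `C`
against the outcome of the measurement ω^(-1/2) ρ_e ω^(-1/2). This is classical side information,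
handled by `sum_abs_bias_le_of_classical_side` with error 4ε; Cauchy-Schwarz turns it into order √ε.
Finally `sum_seed_le` averages over the fixed seed bits: slices too light to have entropy s
contribute little in total. -/

namespace QExtractor

/-! ### Trace norm of Hermitian matrices by duality -/

open scoped MatrixOrder in
/-- The trace of a product of positive semi-definite matrices is nonnegative. -/
theorem trace_mul_re_nonneg {a : Type} [Fintype a] [DecidableEq a] {A B : Matrix a a ℂ}
    (hA : A.PosSemidef) (hB : B.PosSemidef) : 0 ≤ (A * B).trace.re := by
  obtain ⟨C, rfl⟩ := CStarAlgebra.nonneg_iff_eq_star_mul_self.1 hA.nonneg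
  rw [Matrix.star_eq_conjTranspose, Matrix.mul_assoc, Matrix.trace_mul_comm]
  exact (Complex.le_def.1 (hB.mul_mul_conjTranspose_same C).trace_nonneg).1

theorem trace_mul_re_mono {a : Type} [Fintype a] [DecidableEq a] {A B C : Matrix a a ℂ}
    (hA : A.PosSemidef) (h : (C - B).PosSemidef) : (A * B).trace.re ≤ (A * C).trace.re := by
  have := trace_mul_re_nonneg hA h
  rw [Matrix.mul_sub, Matrix.trace_sub, Complex.sub_re] at this
  linarith

theorem posSemidef_trace_re_nonneg {a : Type} [Fintype a] {A : Matrix a a ℂ}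
    (hA : A.PosSemidef) : 0 ≤ A.trace.re :=
  (Complex.le_def.1 hA.trace_nonneg).1

/-- Every function is continuous on the (finite) spectrum of a matrix. -/
theorem continuousOn_spectrum {a : Type} [Fintype a] [DecidableEq a] (A : Matrix a a ℂ)
    (f : ℝ → ℝ) : ContinuousOn f (spectrum ℝ A) :=
  A.finite_real_spectrum.continuousOn f

open scoped MatrixOrder in
theorem posSemidef_cfc {a : Type} [Fintype a] [DecidableEq a] (A : Matrix a a ℂ) {f : ℝ → ℝ}
    (hf : ∀ x, 0 ≤ f x) : (cfc f A).PosSemidef :=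
  Matrix.nonneg_iff_posSemidef.1 (cfc_nonneg fun x _ => hf x)

/-- The trace norm of a Hermitian matrix is the trace of its absolute value. -/
theorem traceNorm_eq_cfc_abs {a : Type} [Fintype a] [DecidableEq a] {A : Matrix a a ℂ}
    (hA : A.IsHermitian) : traceNorm A = (cfc (fun x : ℝ => |x|) A).trace.re := by
  have hA' : IsSelfAdjoint A := hA
  have h : A.conjTranspose * A = cfc (fun x : ℝ => x ^ 2) A := by
    rw [cfc_pow_id A 2 hA', hA.eq, sq]
  rw [traceNorm, h, ← cfc_comp' Real.sqrt (fun x : ℝ => x ^ 2) A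
    (((A.finite_real_spectrum.image _)).continuousOn _) (continuousOn_spectrum A _) hA']
  simp only [Real.sqrt_sq_eq_abs]

/-- The trace norm of a Hermitian matrix is attained on a Hermitian unitary. -/
theorem exists_traceNorm_eq {a : Type} [Fintype a] [DecidableEq a] {A : Matrix a a ℂ}
    (hA : A.IsHermitian) : ∃ U : Matrix a a ℂ, U.IsHermitian ∧ U * U = 1 ∧
      (1 - U).PosSemidef ∧ (1 + U).PosSemidef ∧ traceNorm A = (A * U).trace.re := by
  have hA' : IsSelfAdjoint A := hA
  -- The sign function takes the value 1, not 0, at 0, so that its square is 1 on the whole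
  -- spectrum.
  set f : ℝ → ℝ := fun x => if 0 ≤ x then 1 else -1 with hf
  have c := continuousOn_spectrum A
  have h1 : (1 : Matrix a a ℂ) = cfc (fun _ : ℝ => (1 : ℝ)) A := (cfc_const_one ℝ A).symm
  refine ⟨cfc f A, cfc_predicate f A, ?_, ?_, ?_, ?_⟩
  · rw [← cfc_mul f f A (c _) (c _), h1]
    congr 1
    funext x
    simp only [hf]
    split_ifs <;> norm_num
  · rw [h1, ← cfc_sub _ _ A (c _) (c _)]
    refine posSemidef_cfc A fun x => ?_
    simp only [hf]
    split_ifs <;> norm_num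
  · rw [h1, ← cfc_add A _ _ (c _) (c _)]
    refine posSemidef_cfc A fun x => ?_
    simp only [hf]
    split_ifs <;> norm_num
  · rw [traceNorm_eq_cfc_abs hA]
    have : A * cfc f A = cfc (fun x : ℝ => x * f x) A := by
      rw [cfc_mul (fun x => x) f A (c _) (c _), cfc_id' ℝ A hA']
    rw [this]
    congr 3
    funext x
    simp only [hf]
    split_ifs with h
    · simp [abs_of_nonneg h]
    · simp [abs_of_neg (not_le.1 h)]

/-- The trace norm dominates the pairing with any Hermitian contraction. -/
theorem trace_mul_re_le_traceNorm {a : Type} [Fintype a] [DecidableEq a] {A U : Matrix a a ℂ}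
    (hA : A.IsHermitian) (h₁ : (1 - U).PosSemidef) (h₂ : (1 + U).PosSemidef) :
    (A * U).trace.re ≤ traceNorm A := by
  have hA' : IsSelfAdjoint A := hA
  have c := continuousOn_spectrum A
  set P := cfc (fun x : ℝ => max x 0) A with hP
  set N := cfc (fun x : ℝ => max (-x) 0) A with hN
  have hP0 : P.PosSemidef := posSemidef_cfc A fun x => le_max_right _ _
  have hN0 : N.PosSemidef := posSemidef_cfc A fun x => le_max_right _ _
  have hd : A = P - N := by
    rw [hP, hN, ← cfc_sub _ _ A (c _) (c _)]
    conv_lhs => rw [← cfc_id' ℝ A hA']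
    congr 1
    funext x
    rcases le_total 0 x with h | h
    · simp [h]
    · simp [h]
  have hs : traceNorm A = (P + N).trace.re := by
    rw [traceNorm_eq_cfc_abs hA, hP, hN, ← cfc_add A _ _ (c _) (c _)]
    congr 3
    funext x
    rcases le_total 0 x with h | h
    · simp [h, abs_of_nonneg h]
    · simp [h, abs_of_nonpos h]
  -- tr P(1 - U) ≥ 0 and tr N(1 + U) ≥ 0 add up to tr (P - N)U ≤ tr (P + N).
  have e1 := trace_mul_re_nonneg hP0 h₁
  have e2 := trace_mul_re_nonneg hN0 h₂
  rw [hs, hd]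
  simp only [Matrix.mul_sub, Matrix.mul_add, Matrix.sub_mul, Matrix.trace_sub, Matrix.trace_add,
    Complex.sub_re, Complex.add_re, Matrix.mul_one] at *
  linarith

theorem traceNorm_add_le {a : Type} [Fintype a] [DecidableEq a] {A B : Matrix a a ℂ}
    (hA : A.IsHermitian) (hB : B.IsHermitian) :
    traceNorm (A + B) ≤ traceNorm A + traceNorm B := by
  obtain ⟨U, -, -, h₁, h₂, h⟩ := exists_traceNorm_eq (hA.add hB)
  rw [h, Matrix.add_mul, Matrix.trace_add, Complex.add_re]
  exact add_le_add (trace_mul_re_le_traceNorm hA h₁ h₂) (trace_mul_re_le_traceNorm hB h₁ h₂)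

theorem traceNorm_zero {a : Type} [Fintype a] [DecidableEq a] :
    traceNorm (0 : Matrix a a ℂ) = 0 := by
  obtain ⟨U, -, -, -, -, h⟩ := exists_traceNorm_eq (A := (0 : Matrix a a ℂ)) (by simp)
  simpa using h

theorem traceNorm_posSemidef {a : Type} [Fintype a] [DecidableEq a] {A : Matrix a a ℂ}
    (hA : A.PosSemidef) : traceNorm A = A.trace.re := by
  apply le_antisymm
  · obtain ⟨U, -, -, h₁, -, h⟩ := exists_traceNorm_eq hA.isHermitian
    rw [h]
    simpa using trace_mul_re_mono hA h₁
  · simpa using trace_mul_re_le_traceNorm (U := 1) hA.isHermitian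
      (by simpa using Matrix.PosSemidef.zero) (Matrix.PosSemidef.one.add Matrix.PosSemidef.one)

theorem isHermitian_smul {a : Type} {A : Matrix a a ℂ} (hA : A.IsHermitian) (r : ℝ) :
    (r • A).IsHermitian := by
  rw [Matrix.IsHermitian, Matrix.conjTranspose_smul, hA.eq, star_trivial]

theorem isHermitian_sum {a ι : Type} (s : Finset ι) {A : ι → Matrix a a ℂ}
    (hA : ∀ i ∈ s, (A i).IsHermitian) : (∑ i ∈ s, A i).IsHermitian := by
  rw [Matrix.IsHermitian, Matrix.conjTranspose_sum]
  exact Finset.sum_congr rfl fun i hi => (hA i hi).eq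

theorem traceNorm_smul_le {a : Type} [Fintype a] [DecidableEq a] {A : Matrix a a ℂ}
    (hA : A.IsHermitian) (r : ℝ) : traceNorm (r • A) ≤ |r| * traceNorm A := by
  obtain ⟨U, -, -, h₁, h₂, h⟩ := exists_traceNorm_eq (isHermitian_smul hA r)
  rw [h, Matrix.smul_mul, Matrix.trace_smul, Complex.smul_re, smul_eq_mul]
  have e1 := trace_mul_re_le_traceNorm hA h₁ h₂
  have e2 := trace_mul_re_le_traceNorm (U := -U) hA (by simpa using h₂)
    (by simpa [sub_eq_add_neg] using h₁)
  rw [Matrix.mul_neg, Matrix.trace_neg, Complex.neg_re] at e2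
  rcases abs_cases r with ⟨hr, h0⟩ | ⟨hr, h0⟩ <;> rw [hr] <;> nlinarith

theorem traceNorm_sum_le {a ι : Type} [Fintype a] [DecidableEq a] (s : Finset ι)
    {A : ι → Matrix a a ℂ} (hA : ∀ i ∈ s, (A i).IsHermitian) :
    traceNorm (∑ i ∈ s, A i) ≤ ∑ i ∈ s, traceNorm (A i) := by
  classical
  induction s using Finset.induction_on with
  | empty => simp [traceNorm_zero]
  | insert i s hi ih =>
    rw [Finset.sum_insert hi, Finset.sum_insert hi]
    have h : ∀ j ∈ s, (A j).IsHermitian := fun j hj => hA j (Finset.mem_insert_of_mem hj)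
    exact (traceNorm_add_le (hA i (Finset.mem_insert_self i s)) (isHermitian_sum s h)).trans
      (by gcongr; exact ih h)

/-- The trace norm of a block diagonal matrix is at most the sum of the trace norms of the
blocks. -/
theorem traceNorm_blockDiagonal_le {B E : Type} [Fintype B] [DecidableEq B] [Fintype E]
    [DecidableEq E] {A : B → Matrix E E ℂ} (hA : ∀ b, (A b).IsHermitian) :
    traceNorm (cqState A) ≤ ∑ b, traceNorm (A b) := by
  have hM : (cqState A).IsHermitian := by
    refine isHermitian_sum _ fun b _ => ?_
    rw [Matrix.IsHermitian, Matrix.conjTranspose_kronecker, (hA b).eq]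
    simp [proj]
  obtain ⟨U, -, -, h₁, h₂, h⟩ := exists_traceNorm_eq hM
  -- The pairing sees only the diagonal blocks of the optimal `U`, and these are again contractions.
  have hblock : (cqState A * U).trace.re
      = ∑ b, (A b * U.submatrix (fun e => (b, e)) (fun e => (b, e))).trace.re := by
    rw [← Complex.re_sum]
    congr 1
    simp only [cqState, Finset.sum_mul, Matrix.trace_sum]
    refine Finset.sum_congr rfl fun b _ => ?_
    simp only [Matrix.trace, Matrix.diag, Matrix.mul_apply, Fintype.sum_prod_type,
      Matrix.kroneckerMap_apply, proj, Matrix.single_apply, Matrix.submatrix_apply]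
    rw [Finset.sum_eq_single b]
    · refine Finset.sum_congr rfl fun e _ => ?_
      rw [Finset.sum_eq_single b] <;> simp +contextual [eq_comm]
    · intro b' _ hb
      simp [hb.symm]
    · simp
  rw [h, hblock]
  refine Finset.sum_le_sum fun b _ => trace_mul_re_le_traceNorm (hA b) ?_ ?_
  · have := h₁.submatrix fun e : E => (b, e)
    rwa [Matrix.submatrix_sub, Pi.sub_apply, Pi.sub_apply, Matrix.submatrix_one _
      (Prod.mk_right_injective b)] at this
  · have := h₂.submatrix fun e : E => (b, e)
    rwa [Matrix.submatrix_add, Pi.add_apply, Pi.add_apply, Matrix.submatrix_one _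
      (Prod.mk_right_injective b)] at this

/-! ### Weighted Hölder inequality -/

/-- The Cauchy-Schwarz inequality for the Hilbert-Schmidt inner product of Hermitian matrices. -/
theorem trace_mul_re_sq_le {a : Type} [Fintype a] {A B : Matrix a a ℂ}
    (hA : A.IsHermitian) (hB : B.IsHermitian) :
    (A * B).trace.re ^ 2 ≤ (A * A).trace.re * (B * B).trace.re := by
  have key : ∀ r : ℝ, 0 ≤ (A * A).trace.re * (r * r) + 2 * (A * B).trace.re * r
      + (B * B).trace.re := by
    intro r
    have h := posSemidef_trace_re_nonneg (Matrix.posSemidef_conjTranspose_mul_self (r • A + B))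
    rw [((isHermitian_smul hA r).add hB).eq] at h
    simp only [Matrix.add_mul, Matrix.mul_add, Matrix.smul_mul, Matrix.mul_smul, Matrix.trace_add,
      Matrix.trace_smul, Complex.add_re, Complex.smul_re, smul_eq_mul,
      Matrix.trace_mul_comm B A] at h
    linarith
  have := discrim_le_zero key
  rw [discrim] at this
  linarith

open scoped MatrixOrder in
-- The fourth root lets tr(σU) be split symmetrically as tr(cσc · bUb), a pairing of Hermitian
-- matrices; `b` and `c` are ω^(1/4) and ω^(-1/4).
theorem exists_fourth_root {a : Type} [Fintype a] [DecidableEq a] {ω : Matrix a a ℂ}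
    (hω : ω.PosDef) : ∃ b c : Matrix a a ℂ, b.IsHermitian ∧ c.IsHermitian ∧ b * c = 1 ∧ c * b = 1 ∧
      b * b * (b * b) = ω := by
  set w := CFC.sqrt ω with hw
  set b := CFC.sqrt w with hb
  have hw0 : 0 ≤ w := CFC.sqrt_nonneg ω
  have hb0 : 0 ≤ b := CFC.sqrt_nonneg w
  have h1 : w * w = ω := CFC.sqrt_mul_sqrt_self ω hω.posSemidef.nonneg
  have h2 : b * b = w := CFC.sqrt_mul_sqrt_self w hw0
  have h3 : b * b * (b * b) = ω := by rw [h2, h1]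
  have hbH : b.IsHermitian := (Matrix.nonneg_iff_posSemidef.1 hb0).isHermitian
  have hu : IsUnit b.det := by
    have := (Matrix.isUnit_iff_isUnit_det _).1 hω.isUnit
    rw [← h3, Matrix.det_mul, Matrix.det_mul] at this
    exact isUnit_of_mul_isUnit_left (isUnit_of_mul_isUnit_left this)
  exact ⟨b, b⁻¹, hbH, hbH.inv, Matrix.mul_nonsing_inv b hu, Matrix.nonsing_inv_mul b hu, h3⟩

/-- Hölder's inequality with weight `ω = b ^ 4`, where `c = b⁻¹`. -/
theorem traceNorm_sq_le {a : Type} [Fintype a] [DecidableEq a] {σ b c : Matrix a a ℂ}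
    (hσ : σ.IsHermitian) (hb : b.IsHermitian) (hc : c.IsHermitian) (hbc : b * c = 1)
    (hcb : c * b = 1) :
    traceNorm σ ^ 2 ≤ (b * b * (b * b)).trace.re * (σ * (c * c * σ * (c * c))).trace.re := by
  obtain ⟨U, hU, hUU, -, -, h⟩ := exists_traceNorm_eq hσ
  have hcσ : (c * σ * c).IsHermitian := by
    simp [Matrix.IsHermitian, hc.eq, hσ.eq, Matrix.mul_assoc]
  have hbU : (b * U * b).IsHermitian := by
    simp [Matrix.IsHermitian, hb.eq, hU.eq, Matrix.mul_assoc]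
  have hbb : (b * b).IsHermitian := by simp [Matrix.IsHermitian, hb.eq]
  have hUbU : (U * (b * b) * U).IsHermitian := by
    simp [Matrix.IsHermitian, hb.eq, hU.eq, Matrix.mul_assoc]
  have e0 : (σ * U).trace = (c * σ * c * (b * U * b)).trace := by
    calc (σ * U).trace = ((b * c) * σ * (c * b) * U).trace := by
          rw [hbc, hcb, Matrix.one_mul, Matrix.mul_one]
      _ = (b * (c * σ * c * b * U)).trace := by simp only [Matrix.mul_assoc]
      _ = (c * σ * c * (b * U * b)).trace := by
          rw [Matrix.trace_mul_comm]; simp only [Matrix.mul_assoc]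
  have e1 : (c * σ * c * (c * σ * c)).trace = (σ * (c * c * σ * (c * c))).trace := by
    calc (c * σ * c * (c * σ * c)).trace = (c * (σ * (c * (c * (σ * c))))).trace := by
          simp only [Matrix.mul_assoc]
      _ = _ := by rw [Matrix.trace_mul_comm]; simp only [Matrix.mul_assoc]
  have e2 : (b * U * b * (b * U * b)).trace = (b * b * (U * (b * b) * U)).trace := by
    calc (b * U * b * (b * U * b)).trace = ((b * U * b * b * U) * b).trace := by
          simp only [Matrix.mul_assoc]
      _ = _ := by rw [Matrix.trace_mul_comm]; simp only [Matrix.mul_assoc]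
  have e3 : (U * (b * b) * U * (U * (b * b) * U)).trace = (b * b * (b * b)).trace := by
    calc (U * (b * b) * U * (U * (b * b) * U)).trace
          = (U * (b * b) * (U * U) * (b * b) * U).trace := by simp only [Matrix.mul_assoc]
      _ = ((U * U) * ((b * b) * (b * b))).trace := by
          rw [hUU, Matrix.mul_one, Matrix.trace_mul_comm, ← hUU]; simp only [Matrix.mul_assoc]
      _ = _ := by rw [hUU, Matrix.one_mul]
  -- Cauchy-Schwarz is used twice: on tr(cσc · bUb), and then on tr(b² · Ub²U) to remove `U`, which
  -- need not commute with `b`.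
  have i1 := trace_mul_re_sq_le hcσ hbU
  have i2 := trace_mul_re_sq_le hbb hUbU
  rw [e1, e2] at i1
  rw [e3] at i2
  set W := (b * b * (b * b)).trace.re with hW
  have hW0 : 0 ≤ W := by
    have := posSemidef_trace_re_nonneg (Matrix.posSemidef_conjTranspose_mul_self (b * b))
    rwa [hbb.eq] at this
  have i3 : (b * b * (U * (b * b) * U)).trace.re ≤ W := abs_le_of_sq_le_sq' (by nlinarith) hW0 |>.2
  have i4 : 0 ≤ (σ * (c * c * σ * (c * c))).trace.re := by
    have := posSemidef_trace_re_nonneg (Matrix.posSemidef_conjTranspose_mul_self (c * σ * c))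
    rwa [hcσ.eq, e1] at this
  rw [h, e0]
  calc _ ≤ _ := i1
    _ ≤ _ := by rw [mul_comm]; gcongr

/-! ### Hybrid argument -/

/-- The sign `±1` of a bit. -/
def bitSign (b : Bool) : ℝ := if b then 1 else -1

/-- The bits before `i` are forced and the other m - i are free. In the hybrid argument this count
cancels the weight 2^-(m-i) of a hybrid. -/
theorem card_extensions {m : ℕ} (i : Fin m) (w : BitString m) :
    (Finset.univ.filter fun z : BitString m => ∀ j < i, w j = z j).card = 2 ^ (m - i : ℕ) := by
  have : (Finset.univ.filter fun z : BitString m => ∀ j < i, w j = z j)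
      = Fintype.piFinset fun j => if j < i then {w j} else Finset.univ := by
    ext z
    simp only [Finset.mem_filter, Finset.mem_univ, true_and, Fintype.mem_piFinset]
    refine forall_congr' fun j => ?_
    split_ifs with h
    · simp only [h, true_implies, Finset.mem_singleton]
      exact eq_comm
    · simp [h]
  rw [this, Fintype.card_piFinset]
  simp only [apply_ite Finset.card, Finset.card_singleton, Finset.card_univ, Fintype.card_bool]
  rw [Finset.prod_ite, Finset.prod_const_one, one_mul, Finset.prod_const]
  congr 1
  simp only [not_lt]
  rw [← Fin.card_Ici i]
  congr 1
  ext j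
  simp

/-- The hybrid argument: the distance of an `m`-bit string to uniform is at most the sum of the
distances of its bits to uniform given (a function determining) the previous bits. -/
theorem sum_traceNorm_sub_le {X E : Type} [Fintype X] [Fintype E] [DecidableEq E] {m : ℕ}
    (F : X → BitString m) {ρ : X → Matrix E E ℂ} (hρ : ∀ x, (ρ x).IsHermitian)
    {Γ : Fin m → Type} [∀ i, Fintype (Γ i)] [∀ i, DecidableEq (Γ i)] (G : ∀ i, X → Γ i)
    (φ : ∀ i, Γ i → BitString m) (hφ : ∀ i x, ∀ j < i, φ i (G i x) j = F x j) :
    ∑ z : BitString m, traceNorm ((∑ x, if F x = z then ρ x else 0)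
        - ((2 : ℝ) ^ m)⁻¹ • ∑ x, ρ x)
      ≤ ∑ i, ∑ g, traceNorm (∑ x with G i x = g, bitSign (F x i) • ρ x) := by
  -- The hybrid with the first `i` bits genuine and the rest uniform: uniform output at 0, the true
  -- output at `m`.
  set H : ℕ → BitString m → Matrix E E ℂ := fun i z => ((2 : ℝ) ^ (m - i))⁻¹ •
    ∑ x, if ∀ j : Fin m, (j : ℕ) < i → F x j = z j then ρ x else 0 with hH
  set T : ∀ i : Fin m, Γ i → Matrix E E ℂ := fun i g =>
    ∑ x with G i x = g, bitSign (F x i) • ρ x with hT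
  have hTH : ∀ i g, (T i g).IsHermitian := fun i g =>
    isHermitian_sum _ fun x _ => isHermitian_smul (hρ x) _
  -- Making bit `i` genuine doubles the weight of x if that bit agrees with `z i` and kills it
  -- otherwise, a change by the product of the two signs. The condition on the prefix depends on x
  -- only through `G i x`, so the sum splits into fibres.
  have hstep : ∀ (i : Fin m) z, H (i + 1) z - H i z = (bitSign (z i) * ((2 : ℝ) ^ (m - i : ℕ))⁻¹) •
      ∑ g, if ∀ j < i, φ i g j = z j then T i g else 0 := by
    intro i z
    have hgroup : (∑ g, if ∀ j < i, φ i g j = z j then T i g else 0)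
        = ∑ x, if ∀ j < i, F x j = z j then bitSign (F x i) • ρ x else 0 := by
      rw [← Finset.sum_fiberwise Finset.univ (G i)]
      refine Finset.sum_congr rfl fun g _ => ?_
      have hx : ∀ x ∈ Finset.univ.filter (fun x => G i x = g),
          (if ∀ j < i, F x j = z j then bitSign (F x i) • ρ x else 0)
            = if ∀ j < i, φ i g j = z j then bitSign (F x i) • ρ x else 0 := by
        intro x hx
        have hx : G i x = g := (Finset.mem_filter.1 hx).2
        refine if_congr ?_ rfl rfl
        exact forall₂_congr fun j hj => by rw [← hx, hφ i x j hj]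
      rw [Finset.sum_congr rfl hx]
      split_ifs
      · rfl
      · simp
    have hpow : ((2 : ℝ) ^ (m - (i + 1) : ℕ))⁻¹ = 2 * ((2 : ℝ) ^ (m - i : ℕ))⁻¹ := by
      have : m - (i : ℕ) = (m - (i + 1)) + 1 := by omega
      rw [this, pow_succ]
      field_simp
    rw [hgroup]
    simp only [hH]
    rw [hpow, Finset.smul_sum, Finset.smul_sum, Finset.smul_sum, ← Finset.sum_sub_distrib]
    refine Finset.sum_congr rfl fun x _ => ?_
    have hiff : (∀ j : Fin m, (j : ℕ) < i + 1 → F x j = z j)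
        ↔ (∀ j < i, F x j = z j) ∧ F x i = z i := by
      constructor
      · exact fun h => ⟨fun j hj => h j (by have := Fin.lt_def.1 hj; omega), h i (by omega)⟩
      · rintro ⟨h, h'⟩ j hj
        rcases lt_or_eq_of_le (Nat.lt_succ_iff.1 hj) with hl | hl
        · exact h j hl
        · rwa [Fin.ext hl]
    have hiff' : (∀ j : Fin m, (j : ℕ) < i → F x j = z j) ↔ (∀ j < i, F x j = z j) := Iff.rfl
    simp only [hiff, hiff']
    by_cases h : ∀ j < i, F x j = z j
    · by_cases h' : F x i = z i
      · rw [if_pos ⟨h, h'⟩, if_pos h, if_pos h, h', ← sub_smul, smul_smul]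
        congr 1
        cases z i <;> simp [bitSign] <;> ring
      · rw [if_neg fun hh => h' hh.2, if_pos h, if_pos h, smul_smul, smul_zero, zero_sub, ← neg_smul]
        congr 1
        revert h'
        cases z i <;> cases F x i <;> simp [bitSign]
    · rw [if_neg fun hh => h hh.1, if_neg h, if_neg h]
      simp
  have hbound : ∀ (i : Fin m) z, traceNorm (H (i + 1) z - H i z) ≤
      ∑ g, if ∀ j < i, φ i g j = z j then ((2 : ℝ) ^ (m - i : ℕ))⁻¹ * traceNorm (T i g) else 0 := by
    intro i z
    rw [hstep]
    have hh : ∀ g ∈ (Finset.univ : Finset (Γ i)),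
        (if ∀ j < i, φ i g j = z j then T i g else 0).IsHermitian := by
      intro g _
      split_ifs
      · exact hTH i g
      · exact Matrix.isHermitian_zero
    refine (traceNorm_smul_le (isHermitian_sum _ hh) _).trans ?_
    have habs : |bitSign (z i) * ((2 : ℝ) ^ (m - i : ℕ))⁻¹| = ((2 : ℝ) ^ (m - i : ℕ))⁻¹ := by
      rw [abs_mul, abs_of_pos (by positivity : (0 : ℝ) < ((2 : ℝ) ^ (m - i : ℕ))⁻¹)]
      cases z i <;> simp [bitSign]
    rw [habs]
    refine (mul_le_mul_of_nonneg_left (traceNorm_sum_le _ hh) (by positivity)).trans ?_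
    rw [Finset.mul_sum]
    refine Finset.sum_le_sum fun g _ => ?_
    split_ifs
    · exact le_rfl
    · rw [traceNorm_zero, mul_zero]
  have htel : ∀ z, (∑ x, if F x = z then ρ x else 0) - ((2 : ℝ) ^ m)⁻¹ • ∑ x, ρ x
      = ∑ i : Fin m, (H (i + 1) z - H i z) := by
    intro z
    rw [Fin.sum_univ_eq_sum_range (fun i => H (i + 1) z - H i z) m,
      Finset.sum_range_sub (fun i => H i z) m]
    simp only [hH]
    congr 1
    · simp only [Nat.sub_self, pow_zero, inv_one, one_smul]
      refine Finset.sum_congr rfl fun x _ => if_congr ?_ rfl rfl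
      exact ⟨fun h j _ => by rw [h], fun h => funext fun j => h j j.2⟩
    · simp
  have hHH : ∀ i z, (H i z).IsHermitian := by
    intro i z
    refine isHermitian_smul (isHermitian_sum _ fun x _ => ?_) _
    split_ifs
    · exact hρ x
    · exact Matrix.isHermitian_zero
  calc ∑ z : BitString m, traceNorm ((∑ x, if F x = z then ρ x else 0)
        - ((2 : ℝ) ^ m)⁻¹ • ∑ x, ρ x)
      ≤ ∑ z : BitString m, ∑ i : Fin m, ∑ g, if ∀ j < i, φ i g j = z j then
          ((2 : ℝ) ^ (m - i : ℕ))⁻¹ * traceNorm (T i g) else 0 := by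
        refine Finset.sum_le_sum fun z _ => ?_
        rw [htel z]
        exact (traceNorm_sum_le _ fun i _ => (hHH _ z).sub (hHH _ z)).trans
          (Finset.sum_le_sum fun i _ => hbound i z)
    _ = ∑ i, ∑ g, traceNorm (T i g) := by
        rw [Finset.sum_comm]
        refine Finset.sum_congr rfl fun i _ => ?_
        rw [Finset.sum_comm]
        refine Finset.sum_congr rfl fun g _ => ?_
        rw [← Finset.sum_filter, Finset.sum_const, card_extensions, nsmul_eq_mul]
        push_cast
        field_simp

/-! ### Block structure of classical-quantum states -/

theorem cqState_apply {B E : Type} [Fintype B] [DecidableEq B] (A : B → Matrix E E ℂ)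
    (b b' : B) (e e' : E) :
    cqState A (b, e) (b', e') = if b = b' then A b e e' else 0 := by
  simp only [cqState, Matrix.sum_apply, Matrix.kroneckerMap_apply, proj, Matrix.single_apply]
  rw [Finset.sum_eq_single b]
  · simp
  · intro c _ hc
    simp [hc]
  · simp

theorem isHermitian_cqState {B E : Type} [Fintype B] [DecidableEq B] {A : B → Matrix E E ℂ}
    (hA : ∀ b, (A b).IsHermitian) : (cqState A).IsHermitian := by
  ext ⟨b, e⟩ ⟨b', e'⟩
  rw [Matrix.conjTranspose_apply, cqState_apply, cqState_apply]
  by_cases h : b = b'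
  · subst h
    simpa using (hA b).apply e e'
  · simp [h, Ne.symm h]

theorem partialTraceLeft_cqState {B E : Type} [Fintype B] [DecidableEq B] (A : B → Matrix E E ℂ) :
    partialTraceLeft (cqState A) = ∑ b, A b := by
  ext e e'
  simp [partialTraceLeft, cqState_apply, Matrix.sum_apply]

/-- The distance from uniform of the output of a function with seed and side information is at most
the average over the seed of the sum over the outputs of the distances of the conditional
operators. -/
theorem traceNorm_outputSeedSideState_sub_le {X Y E : Type} [Fintype X] [Fintype Y]
    [DecidableEq X] [DecidableEq Y] [Fintype E] [DecidableEq E] {m : ℕ} (F : X → Y → BitString m)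
    {ρ : X → Matrix E E ℂ} (hρ : ∀ x, (ρ x).IsHermitian) {q : Y → ℝ} (hq : ∀ y, 0 ≤ q y) :
    traceNorm (outputSeedSideState F ρ q - mixedState (BitString m) ⊗ₖ
        (classicalState q ⊗ₖ partialTraceLeft (cqState ρ)))
      ≤ ∑ y, q y * ∑ z, traceNorm ((∑ x, if F x y = z then ρ x else 0)
        - ((2 : ℝ) ^ m)⁻¹ • ∑ x, ρ x) := by
  set D : BitString m → Y → Matrix E E ℂ := fun z y => (∑ x, if F x y = z then ρ x else 0)
        - ((2 : ℝ) ^ m)⁻¹ • ∑ x, ρ x with hD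
  have hDH : ∀ z y, (D z y).IsHermitian := by
    intro z y
    refine (isHermitian_sum _ fun x _ => ?_).sub
      (isHermitian_smul (isHermitian_sum _ fun x _ => hρ x) _)
    split_ifs
    · exact hρ x
    · exact Matrix.isHermitian_zero
  -- The difference is block diagonal in both the output and the seed.
  have heq : outputSeedSideState F ρ q - mixedState (BitString m) ⊗ₖ
        (classicalState q ⊗ₖ partialTraceLeft (cqState ρ))
      = cqState fun z => cqState fun y => q y • D z y := by
    rw [partialTraceLeft_cqState]
    ext ⟨z, y, e⟩ ⟨z', y', e'⟩
    rw [cqState_apply]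
    simp only [Matrix.sub_apply, outputSeedSideState, Matrix.sum_apply, Matrix.smul_apply,
      Matrix.kroneckerMap_apply, proj, Matrix.single_apply, mixedState, classicalState,
      Matrix.one_apply, cqState_apply, hD]
    have hc : (Fintype.card (BitString m) : ℝ) = 2 ^ m := by simp [BitString]
    rw [hc]
    by_cases hz : z = z'
    · subst hz
      by_cases hy : y = y'
      · subst hy
        have : ∀ x, (∑ y', q y' • (((if F x y' = z ∧ F x y' = z then (1 : ℂ) else 0)) *
            ((if y' = y ∧ y' = y then (1 : ℂ) else 0) * ρ x e e')))
            = q y • (if F x y = z then ρ x else 0) e e' := by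
          intro x
          rw [Finset.sum_eq_single y]
          · by_cases h : F x y = z <;> simp [h]
          · intro c _ hc
            simp [hc]
          · simp
        simp only [this]
        simp only [if_true, and_self, ← Finset.smul_sum, smul_sub]
        congr 1
        simp [mul_left_comm]
      · have : ∀ c, ¬(c = y ∧ c = y') := by
          rintro c ⟨rfl, h⟩
          exact hy h
        simp [hy, this]
    · have : ∀ c, ¬(c = z ∧ c = z') := by
        rintro c ⟨rfl, h⟩
        exact hz h
      simp [hz, this]
  rw [heq]
  have hqD : ∀ z y, (q y • D z y).IsHermitian := fun z y => isHermitian_smul (hDH z y) _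
  calc _ ≤ ∑ z, traceNorm (cqState fun y => q y • D z y) :=
        traceNorm_blockDiagonal_le fun z => isHermitian_cqState (hqD z)
    _ ≤ ∑ z, ∑ y, q y * traceNorm (D z y) := by
        refine Finset.sum_le_sum fun z _ => (traceNorm_blockDiagonal_le (hqD z)).trans ?_
        refine Finset.sum_le_sum fun y _ => (traceNorm_smul_le (hDH z y) _).trans_eq ?_
        rw [abs_of_nonneg (hq y)]
    _ = _ := by
        rw [Finset.sum_comm]
        simp only [Finset.mul_sum, hD]

/-! ### One-bit extractors and classical side information -/

theorem posSemidef_diagonal_real {a : Type} [Fintype a] [DecidableEq a] {f : a → ℝ}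
    (hf : ∀ x, 0 ≤ f x) : (Matrix.diagonal fun x => (f x : ℂ)).PosSemidef :=
  Matrix.posSemidef_diagonal_iff.2 fun x => by simpa using hf x

/-- The trace norm of a real diagonal matrix is at least the sum of the absolute values. -/
theorem sum_abs_le_traceNorm_diagonal {a : Type} [Fintype a] [DecidableEq a] (f : a → ℝ) :
    ∑ x, |f x| ≤ traceNorm (Matrix.diagonal fun x => (f x : ℂ)) := by
  set s : a → ℝ := fun x => if 0 ≤ f x then 1 else -1 with hs
  have h := trace_mul_re_le_traceNorm (A := Matrix.diagonal fun x => (f x : ℂ))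
    (U := Matrix.diagonal fun x => (s x : ℂ)) (Matrix.isHermitian_diagonal_of_self_adjoint _
      (by ext x; simp)) ?_ ?_
  · refine le_trans (le_of_eq ?_) h
    rw [Matrix.diagonal_mul_diagonal, Matrix.trace_diagonal, Complex.re_sum]
    refine Finset.sum_congr rfl fun x _ => ?_
    rw [← Complex.ofReal_mul, Complex.ofReal_re]
    simp only [hs]
    split_ifs with h0
    · simp [abs_of_nonneg h0]
    · simp [abs_of_neg (not_le.1 h0)]
  · rw [← Matrix.diagonal_one, Matrix.diagonal_sub]
    have := posSemidef_diagonal_real (f := fun x => 1 - s x) fun x => by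
      simp only [hs]; split_ifs <;> norm_num
    simpa using this
  · rw [← Matrix.diagonal_one, Matrix.diagonal_add]
    have := posSemidef_diagonal_real (f := fun x => 1 + s x) fun x => by
      simp only [hs]; split_ifs <;> norm_num
    simpa using this

/-- For a one-bit function, the distance from uniform is at least the average bias. -/
theorem sum_abs_bias_le {X Y : Type} [Fintype X] [Fintype Y] [DecidableEq Y] (C : X → Y → Bool)
    {p : X → ℝ} (hp : ∑ x, p x = 1) {q : Y → ℝ} (hq : ∀ y, 0 ≤ q y) :
    ∑ y, q y * |∑ x, bitSign (C x y) * p x| ≤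
      traceNorm (outputSeedState C p q - mixedState Bool ⊗ₖ classicalState q) := by
  have heq : outputSeedState C p q - mixedState Bool ⊗ₖ classicalState q
      = Matrix.diagonal fun w : Bool × Y =>
        ((q w.2 * (1 / 2 * bitSign w.1 * ∑ x, bitSign (C x w.2) * p x) : ℝ) : ℂ) := by
    -- Both bit values deviate from 1/2 by half the bias, so the two absolute values add up to the
    -- full bias.
    have hb : ∀ z y, (∑ x, if C x y = z then p x else 0) - 1 / 2
        = 1 / 2 * bitSign z * ∑ x, bitSign (C x y) * p x := by
      intro z y
      have e : (1 : ℝ) / 2 = ∑ x, 1 / 2 * p x := by rw [← Finset.mul_sum, hp, mul_one]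
      rw [Finset.mul_sum]
      conv_lhs => rw [e, ← Finset.sum_sub_distrib]
      refine Finset.sum_congr rfl fun x _ => ?_
      cases C x y <;> cases z <;> simp [bitSign] <;> ring
    ext ⟨z, y⟩ ⟨z', y'⟩
    simp only [← hb]
    simp only [Matrix.sub_apply, outputSeedState, Matrix.sum_apply, Matrix.smul_apply,
      Matrix.kroneckerMap_apply, proj, Matrix.single_apply, mixedState, classicalState,
      Matrix.one_apply, Matrix.diagonal_apply, Prod.mk.injEq, Fintype.card_bool]
    by_cases hz : z = z'
    · subst hz
      by_cases hy : y = y'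
      · subst hy
        have : ∀ x, (∑ y', (p x * q y') • (((if C x y' = z ∧ C x y' = z then (1 : ℂ) else 0)) *
            (if y' = y ∧ y' = y then (1 : ℂ) else 0)))
            = q y * (if C x y = z then p x else 0 : ℝ) := by
          intro x
          rw [Finset.sum_eq_single y]
          · by_cases h : C x y = z <;> simp [h, mul_comm]
          · intro c _ hc
            simp [hc]
          · simp
        simp only [this]
        simp [← Finset.mul_sum, mul_sub, mul_comm]
      · have : ∀ c, ¬(c = y ∧ c = y') := by
          rintro c ⟨rfl, h⟩
          exact hy h
        simp [hy, this]
    · have : ∀ c, ¬(c = z ∧ c = z') := by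
        rintro c ⟨rfl, h⟩
        exact hz h
      simp [hz, this]
  rw [heq]
  refine le_trans (le_of_eq ?_) (sum_abs_le_traceNorm_diagonal _)
  rw [Fintype.sum_prod_type_right]
  refine Finset.sum_congr rfl fun y _ => ?_
  simp only [Fintype.sum_bool, bitSign, abs_mul, abs_of_nonneg (hq y)]
  norm_num
  ring

/-- A distribution has a positive maximum, so the logarithm can be inverted. The pointwise form is
the one that survives rescaling. -/
theorem le_minEntropy_iff {X : Type} [Fintype X] {p : X → ℝ} (hp : p ∈ stdSimplex ℝ X)
    (k : ℝ) : k ≤ minEntropy p ↔ ∀ x, p x ≤ (2 : ℝ) ^ (-k) := by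
  obtain ⟨x₀, hx₀⟩ : ∃ x, 0 < p x := by
    by_contra! h
    have := Finset.sum_nonpos fun x (_ : x ∈ Finset.univ) => h x
    linarith [hp.2]
  have : Nonempty X := ⟨x₀⟩
  have hbdd : BddAbove (Set.range p) := (Set.finite_range p).bddAbove
  have hpos : 0 < ⨆ x, p x := hx₀.trans_le (le_ciSup hbdd x₀)
  rw [minEntropy, le_neg, Real.logb_le_iff_le_rpow one_lt_two hpos, ciSup_le_iff hbdd]

/-- A homogeneous quantity that is small on distributions of min-entropy at least `k` is small on
nonnegative weights bounded by `h`, up to an error `2 ^ k * h`. -/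
theorem le_add_of_forall_minEntropy {X : Type} [Fintype X] {Φ : (X → ℝ) → ℝ} {w : X → ℝ}
    {B h k : ℝ} (hom : ∀ r, 0 ≤ r → ∀ p, Φ (fun x => r * p x) = r * Φ p) (hw : ∀ x, 0 ≤ w x)
    (hwh : ∀ x, w x ≤ h) (hh : 0 ≤ h) (hB : 0 ≤ B) (hΦw : Φ w ≤ ∑ x, w x)
    (hΦ : ∀ p ∈ stdSimplex ℝ X, k ≤ minEntropy p → Φ p ≤ B) :
    Φ w ≤ B * ∑ x, w x + (2 : ℝ) ^ k * h := by
  have hW : 0 ≤ ∑ x, w x := Finset.sum_nonneg fun x _ => hw x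
  have hk : 0 ≤ (2 : ℝ) ^ k * h := by positivity
  -- Light weights are covered by the trivial bound `hΦw`; heavy ones, once normalized, have entries
  -- at most h / W ≤ 2^(-k).
  rcases le_or_gt (∑ x, w x) ((2 : ℝ) ^ k * h) with hle | hlt
  · have := mul_nonneg hB hW
    linarith
  · set W := ∑ x, w x with hWdef
    have hW0 : 0 < W := hk.trans_lt hlt
    have hp : (fun x => W⁻¹ * w x) ∈ stdSimplex ℝ X :=
      ⟨fun x => mul_nonneg (inv_nonneg.2 hW) (hw x), by
        rw [← Finset.mul_sum, ← hWdef, inv_mul_cancel₀ hW0.ne']⟩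
    have hent : k ≤ minEntropy fun x => W⁻¹ * w x := by
      rw [le_minEntropy_iff hp]
      intro x
      rw [Real.rpow_neg zero_le_two, inv_mul_le_iff₀ hW0, ← div_eq_mul_inv,
        le_div_iff₀ (by positivity), mul_comm]
      exact (mul_le_mul_of_nonneg_left (hwh x) (by positivity)).trans hlt.le
    have h1 := hΦ _ hp hent
    rw [hom _ (inv_nonneg.2 hW), inv_mul_le_iff₀ hW0] at h1
    linarith [mul_comm W B]

theorem abs_bitSign_mul (b : Bool) (r : ℝ) : |bitSign b * r| = |r| := by
  cases b <;> simp [bitSign]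

/-- One-bit strong extractors work for classical side information: `P e x` is the probability of
`X = x` and side information `e`, and `∑ e, h e` bounds the guessing probability. -/
theorem sum_abs_bias_le_of_classical_side {n t : ℕ} {C : BitString n → BitString t → Bool}
    {k ε s : ℝ} (hε : 0 < ε) (hC : IsStrongExtractor C k ε s) {I : Type} [Fintype I]
    {P : I → BitString n → ℝ} {h : I → ℝ} (hP : ∀ e x, 0 ≤ P e x) (hPh : ∀ e x, P e x ≤ h e)
    (hsum : ∑ e, ∑ x, P e x ≤ 1) (hguess : (2 : ℝ) ^ k * ∑ e, h e ≤ 2 * ε) {q : BitString t → ℝ}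
    (hq : q ∈ stdSimplex ℝ (BitString t)) (hs : s ≤ minEntropy q) :
    ∑ a, q a * ∑ e, |∑ x, bitSign (C x a) * P e x| ≤ 4 * ε := by
  -- For a fixed outcome `e` the slice `P e` is an unnormalized source. The constant 2ε undoes the
  -- factor 1/2 in the definition of extractors.
  have key : ∀ e, ∑ a, q a * |∑ x, bitSign (C x a) * P e x|
      ≤ 2 * ε * ∑ x, P e x + (2 : ℝ) ^ k * h e := by
    intro e
    refine le_add_of_forall_minEntropy
      (Φ := fun p => ∑ a, q a * |∑ x, bitSign (C x a) * p x|) ?_ (hP e) (hPh e)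
      ((hP e default).trans (hPh e default)) (by positivity) ?_ ?_
    · intro r hr p
      rw [Finset.mul_sum]
      refine Finset.sum_congr rfl fun a _ => ?_
      simp only [mul_left_comm _ r, ← Finset.mul_sum, abs_mul, abs_of_nonneg hr]
    · calc ∑ a, q a * |∑ x, bitSign (C x a) * P e x| ≤ ∑ a, q a * ∑ x, P e x := by
            refine Finset.sum_le_sum fun a _ => mul_le_mul_of_nonneg_left ?_ (hq.1 a)
            refine (Finset.abs_sum_le_sum_abs _ _).trans_eq ?_
            simp only [abs_bitSign_mul, abs_of_nonneg (hP e _)]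
        _ = ∑ x, P e x := by rw [← Finset.sum_mul, hq.2, one_mul]
    · intro p hp hkp
      have h1 := hC p hp hkp q hq hs
      have h2 := sum_abs_bias_le C hp.2 hq.1
      linarith
  calc ∑ a, q a * ∑ e, |∑ x, bitSign (C x a) * P e x|
      = ∑ e, ∑ a, q a * |∑ x, bitSign (C x a) * P e x| := by
        simp only [Finset.mul_sum]
        exact Finset.sum_comm
    _ ≤ ∑ e, (2 * ε * ∑ x, P e x + (2 : ℝ) ^ k * h e) := Finset.sum_le_sum fun e _ => key e
    _ = 2 * ε * ∑ e, ∑ x, P e x + (2 : ℝ) ^ k * ∑ e, h e := by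
        rw [Finset.sum_add_distrib, ← Finset.mul_sum, ← Finset.mul_sum]
    _ ≤ 4 * ε := by nlinarith

/-! ### From quantum to classical side information -/

theorem trace_re_sum {a ι : Type} [Fintype a] (s : Finset ι) (A : ι → Matrix a a ℂ) :
    (∑ i ∈ s, A i).trace.re = ∑ i ∈ s, (A i).trace.re := by
  rw [Matrix.trace_sum, Complex.re_sum]

theorem trace_mul_re_comm {a : Type} [Fintype a] (A B : Matrix a a ℂ) :
    (A * B).trace.re = (B * A).trace.re := by
  rw [Matrix.trace_mul_comm]

theorem trace_smul_mul_re {a : Type} [Fintype a] (r : ℝ) (A B : Matrix a a ℂ) :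
    (r • A * B).trace.re = r * (A * B).trace.re := by
  rw [Matrix.smul_mul, Matrix.trace_smul, Complex.smul_re, smul_eq_mul]

/-- One-bit strong extractors work for quantum side information consisting of a system `E` together
with a function `G` of the source. The pretty good measurement reduces this to classical side
information. -/
theorem sum_traceNorm_bias_le {n t : ℕ} {C : BitString n → BitString t → Bool}
    {k ε s : ℝ} (hε : 0 < ε) (hC : IsStrongExtractor C k ε s) {E Γ : Type} [Fintype E]
    [DecidableEq E] [Fintype Γ] [DecidableEq Γ] {ρ : BitString n → Matrix E E ℂ}
    (hρ : ∀ x, (ρ x).PosSemidef) (htr : ∑ x, (ρ x).trace.re ≤ 1) (G : BitString n → Γ)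
    {σ : Matrix E E ℂ} (hσ : IsState σ) {c : ℝ} (hσρ : ∀ x, (c • σ - ρ x).PosSemidef)
    (hc0 : 0 ≤ c) (hc : (2 : ℝ) ^ k * (c * Fintype.card Γ) ≤ 2 * ε) {q : BitString t → ℝ}
    (hq : q ∈ stdSimplex ℝ (BitString t)) (hs : s ≤ minEntropy q) :
    ∑ a, q a * ∑ g, traceNorm (∑ x with G x = g, bitSign (C x a) • ρ x) ≤ 3 * Real.sqrt ε := by
  -- The regularization δ makes every `ω g` invertible while adding at most 1 to the total trace.
  obtain ⟨δ, hδ0, hδ⟩ : ∃ δ : ℝ, 0 < δ ∧ δ * (Fintype.card Γ * Fintype.card E) ≤ 1 := by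
    refine ⟨(Fintype.card Γ * Fintype.card E + 1 : ℝ)⁻¹, by positivity, ?_⟩
    rw [inv_mul_le_iff₀ (by positivity)]
    linarith
  set ω : Γ → Matrix E E ℂ := fun g => (∑ x with G x = g, ρ x) + δ • (1 : Matrix E E ℂ) with hω
  have hfib : ∀ g, (∑ x with G x = g, ρ x).PosSemidef := fun g =>
    Matrix.posSemidef_sum _ fun x _ => hρ x
  have hωpos : ∀ g, (ω g).PosDef := fun g =>
    Matrix.PosDef.posSemidef_add (hfib g) (Matrix.PosDef.one.smul hδ0)
  choose b d hb hd hbd hdb hbω using fun g => exists_fourth_root (hωpos g)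
  set W : Γ → Matrix E E ℂ := fun g => d g * d g with hW
  have hWH : ∀ g, (W g).IsHermitian := fun g => by
    simp [hW, Matrix.IsHermitian, (hd g).eq]
  have hWω : ∀ g, W g * ω g * W g = 1 := by
    intro g
    calc W g * ω g * W g = d g * ((d g * b g) * b g) * (b g * (b g * d g)) * d g := by
          rw [← hbω g]; simp only [hW, Matrix.mul_assoc]
      _ = 1 := by simp [hdb, hbd]
  -- Pretty good measurement: `W g` is ω_g^(-1/2), and on each fibre the operators sum to 1 minus
  -- the positive defect δ W².
  set M : BitString n → Matrix E E ℂ := fun x => W (G x) * ρ x * W (G x) with hM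
  have hMpos : ∀ x, (M x).PosSemidef := fun x => by
    have := (hρ x).mul_mul_conjTranspose_same (W (G x))
    rwa [(hWH _).eq] at this
  have hMsum : ∀ g, (1 - ∑ x with G x = g, M x).PosSemidef := by
    intro g
    have h1 : ∑ x with G x = g, M x = W g * (∑ x with G x = g, ρ x) * W g := by
      rw [Finset.mul_sum, Finset.sum_mul]
      refine Finset.sum_congr rfl fun x hx => ?_
      rw [hM, ← (Finset.mem_filter.1 hx).2]
    have h2 : 1 - ∑ x with G x = g, M x = δ • (W g * W g) := by
      rw [h1, ← hWω g, hω]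
      simp [Matrix.mul_add, Matrix.add_mul]
    rw [h2]
    have h3 := Matrix.posSemidef_conjTranspose_mul_self (W g)
    rw [(hWH g).eq] at h3
    exact h3.smul hδ0.le
  -- Joint weight of source x and outcome `e`. The register value is read first and selects the
  -- measurement, so outcomes from other fibres have weight 0.
  set P : BitString n → BitString n → ℝ := fun e x =>
    if G x = G e then (ρ x * M e).trace.re else 0 with hP
  -- Since ρ_x ≤ cσ for all x, this dominates column `e`; each fibre contributes at most c tr σ = c,
  -- hence the total c |Γ|.
  set h : BitString n → ℝ := fun e => c * (σ * M e).trace.re with hh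
  have hP0 : ∀ e x, 0 ≤ P e x := by
    intro e x
    simp only [hP]
    split_ifs
    · exact trace_mul_re_nonneg (hρ x) (hMpos e)
    · exact le_rfl
  have hPh : ∀ e x, P e x ≤ h e := by
    intro e x
    have h1 := trace_mul_re_mono (hMpos e) (hσρ x)
    rw [trace_mul_re_comm _ (c • σ), trace_mul_re_comm _ (ρ x), trace_smul_mul_re] at h1
    have h2 := trace_mul_re_nonneg (hρ x) (hMpos e)
    simp only [hP, hh]
    split_ifs
    · exact h1
    · exact h2.trans h1
  have hpovm : ∀ {A : Matrix E E ℂ}, A.PosSemidef → ∀ g,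
      ∑ e with G e = g, (A * M e).trace.re ≤ A.trace.re := by
    intro A hA g
    have := trace_mul_re_mono hA (hMsum g)
    rwa [Finset.mul_sum, trace_re_sum, Matrix.mul_one] at this
  have hPsum : ∑ e, ∑ x, P e x ≤ 1 := by
    rw [Finset.sum_comm]
    refine (Finset.sum_le_sum fun x _ => ?_).trans htr
    simp only [hP]
    rw [← Finset.sum_filter]
    simp only [eq_comm (a := G x)]
    exact hpovm (hρ x) _
  have hhsum : ∑ e, h e ≤ c * Fintype.card Γ := by
    simp only [hh]
    rw [← Finset.mul_sum]
    refine mul_le_mul_of_nonneg_left ?_ hc0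
    rw [← Finset.sum_fiberwise Finset.univ G]
    refine (Finset.sum_le_sum fun g _ => hpovm hσ.1 g).trans_eq ?_
    simp [hσ.2]
  have hcl := sum_abs_bias_le_of_classical_side hε hC hP0 hPh hPsum
    ((mul_le_mul_of_nonneg_left hhsum (by positivity)).trans hc) hq hs
  set V : BitString t → Γ → ℝ := fun a g =>
    ∑ e with G e = g, |∑ x, bitSign (C x a) * P e x| with hV
  have hV0 : ∀ a g, 0 ≤ V a g := fun a g => Finset.sum_nonneg fun e _ => abs_nonneg _
  have hω0 : ∀ g, 0 ≤ (ω g).trace.re := fun g => posSemidef_trace_re_nonneg (hωpos g).posSemidef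
  have hτ : ∀ a g, (∑ x with G x = g, bitSign (C x a) • ρ x).IsHermitian := fun a g =>
    isHermitian_sum _ fun x _ => isHermitian_smul (hρ x).isHermitian _
  have hholder : ∀ a g, traceNorm (∑ x with G x = g, bitSign (C x a) • ρ x)
      ≤ Real.sqrt ((ω g).trace.re * V a g) := by
    intro a g
    refine Real.le_sqrt_of_sq_le ?_
    have h1 := traceNorm_sq_le (hτ a g) (hb g) (hd g) (hbd g) (hdb g)
    rw [hbω g] at h1
    refine h1.trans (mul_le_mul_of_nonneg_left ?_ (hω0 g))
    change ((∑ x with G x = g, bitSign (C x a) • ρ x) *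
      (W g * (∑ x with G x = g, bitSign (C x a) • ρ x) * W g)).trace.re ≤ V a g
    have h3 : W g * (∑ e with G e = g, bitSign (C e a) • ρ e) * W g
        = ∑ e with G e = g, W g * bitSign (C e a) • ρ e * W g := by
      rw [Finset.mul_sum, Finset.sum_mul]
    -- Only the second copy of the signed sum is expanded; its summand at `e` is, up to a sign, the
    -- bias of `C` against outcome `e`.
    rw [h3, Finset.mul_sum, trace_re_sum]
    refine Finset.sum_le_sum fun e he => ?_
    have he : G e = g := (Finset.mem_filter.1 he).2
    have h2 : ((∑ x with G x = g, bitSign (C x a) • ρ x) *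
        (W g * bitSign (C e a) • ρ e * W g)).trace.re
        = bitSign (C e a) * ∑ x, bitSign (C x a) * P e x := by
      rw [Matrix.mul_smul, Matrix.smul_mul, trace_mul_re_comm, trace_smul_mul_re, Finset.mul_sum,
        trace_re_sum, Finset.sum_filter]
      congr 1
      refine Finset.sum_congr rfl fun x _ => ?_
      simp only [hP, hM, he]
      split_ifs
      · rw [trace_mul_re_comm, trace_smul_mul_re]
      · rw [mul_zero]
    rw [h2]
    exact (le_abs_self _).trans_eq (abs_bitSign_mul _ _)
  have hωsum : ∑ g, (ω g).trace.re ≤ 2 := by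
    simp only [hω, Matrix.trace_add, Complex.add_re, Finset.sum_add_distrib, trace_re_sum]
    rw [Finset.sum_fiberwise]
    have : ∑ _g : Γ, (δ • (1 : Matrix E E ℂ)).trace.re
        = δ * (Fintype.card Γ * Fintype.card E) := by
      simp [Matrix.trace_smul, mul_left_comm]
    rw [this]
    linarith
  -- Cauchy-Schwarz over pairs (a, g) with weights q a; the factors 2 and 4ε give √(8ε) ≤ 3√ε.
  calc ∑ a, q a * ∑ g, traceNorm (∑ x with G x = g, bitSign (C x a) • ρ x)
      ≤ ∑ a, ∑ g, Real.sqrt (q a * (ω g).trace.re) * Real.sqrt (q a * V a g) := by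
        refine Finset.sum_le_sum fun a _ => ?_
        rw [Finset.mul_sum]
        refine Finset.sum_le_sum fun g _ => ?_
        refine (mul_le_mul_of_nonneg_left (hholder a g) (hq.1 a)).trans_eq ?_
        rw [← Real.sqrt_mul (mul_nonneg (hq.1 a) (hω0 g)), mul_mul_mul_comm,
          Real.sqrt_mul (mul_self_nonneg _), Real.sqrt_mul_self (hq.1 a)]
    _ = ∑ w : BitString t × Γ, Real.sqrt (q w.1 * (ω w.2).trace.re)
          * Real.sqrt (q w.1 * V w.1 w.2) := by rw [Fintype.sum_prod_type]
    _ ≤ Real.sqrt (∑ w : BitString t × Γ, q w.1 * (ω w.2).trace.re)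
          * Real.sqrt (∑ w : BitString t × Γ, q w.1 * V w.1 w.2) :=
        Real.sum_sqrt_mul_sqrt_le _ (fun w => mul_nonneg (hq.1 _) (hω0 _))
          (fun w => mul_nonneg (hq.1 _) (hV0 _ _))
    _ ≤ Real.sqrt 2 * Real.sqrt (4 * ε) := by
        gcongr
        · rw [Fintype.sum_prod_type]
          simp only [← Finset.mul_sum]
          rw [← Finset.sum_mul, hq.2, one_mul]
          exact hωsum
        · rw [Fintype.sum_prod_type]
          simp only [← Finset.mul_sum, hV]
          simpa only [Finset.sum_fiberwise] using hcl
    _ ≤ 3 * Real.sqrt ε := by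
        rw [← Real.sqrt_mul zero_le_two]
        refine Real.sqrt_le_iff.2 ⟨by positivity, ?_⟩
        rw [mul_pow, Real.sq_sqrt hε.le]
        linarith

/-! ### Conditioning the seed -/

/-- A bit string splits into its bits in `S` and its bits outside `S`. -/
def splitAt {d t : ℕ} (S : Finset (Fin d)) (hS : S.card = t) :
    BitString d ≃ BitString t × ({l // l ∉ S} → Bool) :=
  (Equiv.piEquivPiSubtypeProd (fun l => l ∈ S) fun _ => Bool).trans
    ((Equiv.arrowCongr (S.orderIsoOfFin hS).symm.toEquiv (Equiv.refl Bool)).prodCongr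
      (Equiv.refl _))

theorem splitAt_apply {d t : ℕ} (S : Finset (Fin d)) (hS : S.card = t) (y : BitString d) :
    splitAt S hS y = (substring y S hS, fun l : {l // l ∉ S} => y l) := rfl

/-- The average over the seed of a quantity that is small whenever the bits in `S` have min-entropy
at least `s` (for every value of the bits outside `S`). -/
theorem sum_seed_le {d t : ℕ} (S : Finset (Fin d)) (hS : S.card = t)
    {q : BitString d → ℝ} (hq : q ∈ stdSimplex ℝ (BitString d)) {K B s : ℝ}
    (hqK : ∀ y, q y ≤ K) (hB : 0 ≤ B) {f : BitString t → ({l // l ∉ S} → Bool) → ℝ}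
    (hf : ∀ a v, f a v ≤ 1)
    (hfB : ∀ v, ∀ p ∈ stdSimplex ℝ (BitString t), s ≤ minEntropy p → ∑ a, p a * f a v ≤ B) :
    ∑ y, q y * f (substring y S hS) (fun l => y l)
      ≤ B + (2 : ℝ) ^ s * K * (2 : ℝ) ^ ((d : ℝ) - t) := by
  set e := splitAt S hS with he
  have hK : 0 ≤ K := (hq.1 default).trans (hqK default)
  -- With `v` fixed, the slice of `q` is an unnormalized seed with entries at most `K`. Its error
  -- 2^s K is paid once for each of the 2^(d-t) values of `v`.
  have key : ∀ v, ∑ a, q (e.symm (a, v)) * f a v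
      ≤ B * ∑ a, q (e.symm (a, v)) + (2 : ℝ) ^ s * K := by
    intro v
    refine le_add_of_forall_minEntropy (Φ := fun p => ∑ a, p a * f a v) ?_ (fun a => hq.1 _)
      (fun a => hqK _) hK hB ?_ (hfB v)
    · intro r _ p
      simp only [Finset.mul_sum, mul_assoc]
    · exact Finset.sum_le_sum fun a _ => mul_le_of_le_one_right (hq.1 _) (hf a v)
  have hcard : (Fintype.card ({l // l ∉ S} → Bool) : ℝ) = (2 : ℝ) ^ ((d : ℝ) - t) := by
    have h1 : t ≤ d := by
      rw [← hS]
      simpa using S.card_le_univ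
    rw [← Nat.cast_sub h1, Real.rpow_natCast, Fintype.card_fun, Fintype.card_bool,
      Fintype.card_subtype_compl]
    simp [hS]
  calc ∑ y, q y * f (substring y S hS) (fun l => y l)
      = ∑ w : BitString t × ({l // l ∉ S} → Bool), q (e.symm w) * f w.1 w.2 :=
        Fintype.sum_equiv e _ _ fun y => by rw [Equiv.symm_apply_apply, he, splitAt_apply]
    _ = ∑ v, ∑ a, q (e.symm (a, v)) * f a v := Fintype.sum_prod_type_right _
    _ ≤ ∑ v, (B * ∑ a, q (e.symm (a, v)) + (2 : ℝ) ^ s * K) :=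
        Finset.sum_le_sum fun v _ => key v
    _ = B * ∑ y, q y + Fintype.card ({l // l ∉ S} → Bool) * ((2 : ℝ) ^ s * K) := by
        rw [Finset.sum_add_distrib, ← Finset.mul_sum, ← Fintype.sum_prod_type_right
          fun w => q (e.symm w), Equiv.sum_comp e.symm q]
        simp
    _ = _ := by rw [hq.2, hcard]; ring

/-! ### Truth tables and the weak design -/

/-- The truth tables of the output bits before the `i`-th one, as functions of the bits of the seed
shared with the `i`-th one. -/
abbrev TruthTables {m d : ℕ} (S : Fin m → Finset (Fin d)) (i : Fin m) : Type :=
  ∀ j : {j // j < i}, ({l // l ∈ S j ∩ S i} → Bool) → Bool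

/-- The truth tables of the bits of `trevisan C S hS x` before the `i`-th one, when the seed is `v`
outside `S i`. -/
def truthTables {n t d m : ℕ} (C : BitString n → BitString t → Bool)
    (S : Fin m → Finset (Fin d)) (hS : ∀ i, (S i).card = t) (i : Fin m)
    (v : {l // l ∉ S i} → Bool) (x : BitString n) : TruthTables S i :=
  -- The final `false` fills positions in `S i` outside `S j`, which `substring` never reads.
  fun j b => C x (substring (fun l => if h : l ∈ S j ∩ S i then b ⟨l, h⟩ else
    if h' : l ∉ S i then v ⟨l, h'⟩ else false) (S j) (hS j))

/-- A position of `S j` lies either in `S i`, where the argument of the table supplies the bit, or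
outside it, where `v` does. So tables and seed recover the earlier bits, as the hybrid argument
requires. -/
theorem truthTables_apply {n t d m : ℕ} (C : BitString n → BitString t → Bool)
    (S : Fin m → Finset (Fin d)) (hS : ∀ i, (S i).card = t) (i : Fin m)
    (y : BitString d) (x : BitString n) (j : {j // j < i}) :
    truthTables C S hS i (fun l => y l) x j (fun l => y l) = trevisan C S hS x y j := by
  refine congrArg (C x) (funext fun l => ?_)
  have hl : (S j).orderEmbOfFin (hS j) l ∈ S j := Finset.orderEmbOfFin_mem _ _ _
  simp only [substring, Finset.mem_inter, hl, true_and]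
  by_cases h : (S j).orderEmbOfFin (hS j) l ∈ S i <;> simp [h]

/-- A table on |S_j ∩ S_i| bits has 2^|S_j ∩ S_i| entries, so the exponents add up to exactly the
sum that a weak design bounds. -/
theorem card_truthTables_le {m d t : ℕ} {S : Fin m → Finset (Fin d)} {r : ℝ}
    (hS : IsWeakDesign S t r) (i : Fin m) :
    (Fintype.card (TruthTables S i) : ℝ) ≤ (2 : ℝ) ^ (r * m) := by
  have h1 : (Fintype.card (TruthTables S i) : ℝ)
      = (2 : ℝ) ^ (∑ j ∈ Finset.univ.filter (fun j => j < i), (2 : ℝ) ^ (S j ∩ S i).card) := by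
    rw [Fintype.card_pi]
    push_cast
    rw [Real.rpow_sum_of_pos two_pos, Finset.prod_subtype (Finset.univ.filter fun j => j < i)
      (p := fun j => j < i) (by simp)]
    refine Finset.prod_congr rfl fun j _ => ?_
    rw [Fintype.card_fun, Fintype.card_fun, Fintype.card_bool, Fintype.card_coe]
    push_cast
    rw [← Real.rpow_natCast]
    push_cast
    rfl
  rw [h1]
  exact Real.rpow_le_rpow_of_exponent_le one_le_two (hS.sum_le i)

/-! ### Min-entropy bounds and assembly -/

theorem posSemidef_of_cqState {X E : Type} [Fintype X] [DecidableEq X] {ρ : X → Matrix E E ℂ}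
    (h : (cqState ρ).PosSemidef) (x : X) : (ρ x).PosSemidef := by
  have : ρ x = (cqState ρ).submatrix (fun e => (x, e)) fun e => (x, e) := by
    ext e e'
    simp [cqState_apply]
  rw [this]
  exact h.submatrix _

theorem trace_cqState {X E : Type} [Fintype X] [DecidableEq X] [Fintype E]
    (ρ : X → Matrix E E ℂ) : (cqState ρ).trace = ∑ x, (ρ x).trace := by
  simp [Matrix.trace, Fintype.sum_prod_type, cqState_apply]

/-- A lower bound on the conditional min-entropy of a classical-quantum state bounds its
conditional operators, up to a factor `2`, by a multiple of a state. -/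
theorem exists_state_of_le_condMinEntropy {X E : Type} [Fintype X] [DecidableEq X] [Fintype E]
    {ρ : X → Matrix E E ℂ} {k : ℝ} (h : (k : EReal) ≤ condMinEntropy (cqState ρ)) :
    ∃ σ : Matrix E E ℂ, IsState σ ∧ ∃ c : ℝ, 0 ≤ c ∧ c ≤ 2 * (2 : ℝ) ^ (-k) ∧
      ∀ x, (c • σ - ρ x).PosSemidef := by
  -- Giving up one bit of entropy avoids proving that the supremum is attained; this is the source
  -- of the factor 2.
  have hlt : ((k - 1 : ℝ) : EReal) < condMinEntropy (cqState ρ) :=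
    lt_of_lt_of_le (EReal.coe_lt_coe_iff.2 (by linarith)) h
  obtain ⟨-, ⟨lam, rfl, σ, hσ, hpos⟩, hlam⟩ := lt_sSup_iff.1 hlt
  have hlam : k - 1 < lam := EReal.coe_lt_coe_iff.1 hlam
  refine ⟨σ, hσ, (2 : ℝ) ^ (-lam), by positivity, ?_, fun x => ?_⟩
  · calc (2 : ℝ) ^ (-lam) ≤ (2 : ℝ) ^ (1 + -k) :=
          Real.rpow_le_rpow_of_exponent_le one_le_two (by linarith)
      _ = _ := by rw [Real.rpow_add two_pos, Real.rpow_one]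
  · convert hpos.submatrix fun e : E => (x, e) using 1
    ext e e'
    simp [cqState_apply]

end QExtractor

theorem mainTheorem2 (n t d m : ℕ) (k ε s r : ℝ) (hε : 0 < ε)
    (C : QExtractor.BitString n → QExtractor.BitString t → Bool)
    (hC : QExtractor.IsStrongExtractor C k ε s)
    (S : Fin m → Finset (Fin d)) (hS : QExtractor.IsWeakDesign S t r) :
    QExtractor.IsQuantumProofStrongExtractor (QExtractor.trevisan C S hS.card_eq)
      (k + r * m + Real.logb 2 (1 / ε)) (6 * m * Real.sqrt ε)
      (d - (t - s - Real.logb 2 (1 / (3 * Real.sqrt ε)))) := by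
  intro E _ _ ρ hρ hent q hq hqs
  have hpos := QExtractor.posSemidef_of_cqState hρ.1
  have htr : ∑ x, (ρ x).trace.re ≤ 1 := by
    have := hρ.2
    rwa [QExtractor.trace_cqState, Complex.re_sum] at this
  obtain ⟨σ, hσ, c, hc0, hc, hσρ⟩ := QExtractor.exists_state_of_le_condMinEntropy hent
  set f : ∀ i : Fin m, QExtractor.BitString t → ({l // l ∉ S i} → Bool) → ℝ := fun i a v =>
    ∑ g, QExtractor.traceNorm (∑ x with QExtractor.truthTables C S hS.card_eq i v x = g,
      QExtractor.bitSign (C x a) • ρ x) with hf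
  have hf1 : ∀ i a v, f i a v ≤ 1 := by
    intro i a v
    refine le_trans ?_ htr
    rw [← Finset.sum_fiberwise Finset.univ (QExtractor.truthTables C S hS.card_eq i v)]
    refine Finset.sum_le_sum fun g _ => (QExtractor.traceNorm_sum_le _ fun x _ =>
      QExtractor.isHermitian_smul (hpos x).isHermitian _).trans (Finset.sum_le_sum fun x _ => ?_)
    refine (QExtractor.traceNorm_smul_le (hpos x).isHermitian _).trans_eq ?_
    rw [QExtractor.traceNorm_posSemidef (hpos x)]
    cases C x a <;> simp [QExtractor.bitSign]
  -- The entropy k + rm + log(1/ε) is spent here: rm pays for the tables, and log(1/ε) leaves the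
  -- factor ε.
  have hguess : ∀ i, (2 : ℝ) ^ k * (c * Fintype.card (QExtractor.TruthTables S i)) ≤ 2 * ε := by
    intro i
    calc (2 : ℝ) ^ k * (c * Fintype.card (QExtractor.TruthTables S i))
        ≤ (2 : ℝ) ^ k * (2 * (2 : ℝ) ^ (-(k + r * m + Real.logb 2 (1 / ε))) * 2 ^ (r * m)) := by
          gcongr
          exact QExtractor.card_truthTables_le hS i
      _ = 2 * (2 : ℝ) ^ (k + -(k + r * m + Real.logb 2 (1 / ε)) + r * m) := by
          rw [Real.rpow_add two_pos, Real.rpow_add two_pos]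
          ring
      _ = 2 * ε := by
          have : k + -(k + r * m + Real.logb 2 (1 / ε)) + r * m = Real.logb 2 ε := by
            rw [one_div, Real.logb_inv]
            ring
          rw [this, Real.rpow_logb two_pos (by norm_num) hε]
  have hfB : ∀ i v, ∀ p ∈ stdSimplex ℝ (QExtractor.BitString t), s ≤ QExtractor.minEntropy p →
      ∑ a, p a * f i a v ≤ 3 * Real.sqrt ε := fun i v p hp hps =>
    QExtractor.sum_traceNorm_bias_le hε hC hpos htr _ hσ hσρ hc0 (hguess i) hp hps
  -- The seed entropy is tuned so that the loss from light slices equals the main term 3√ε.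
  have hseed : ∀ i, ∑ y, q y * f i (QExtractor.substring y (S i) (hS.card_eq i)) (fun l => y l)
      ≤ 6 * Real.sqrt ε := by
    intro i
    refine (QExtractor.sum_seed_le (S i) (hS.card_eq i) hq
      ((QExtractor.le_minEntropy_iff hq _).1 hqs) (by positivity) (hf1 i) (hfB i)).trans_eq ?_
    have hε' : 0 < 3 * Real.sqrt ε := by positivity
    rw [← Real.rpow_add two_pos, ← Real.rpow_add two_pos]
    have : s + -(d - (t - s - Real.logb 2 (1 / (3 * Real.sqrt ε)))) + ((d : ℝ) - t)
        = Real.logb 2 (3 * Real.sqrt ε) := by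
      rw [one_div, Real.logb_inv]
      ring
    rw [this, Real.rpow_logb two_pos (by norm_num) hε']
    ring
  have hhyb : ∀ y, ∑ z, QExtractor.traceNorm
      ((∑ x, if QExtractor.trevisan C S hS.card_eq x y = z then ρ x else 0)
        - ((2 : ℝ) ^ m)⁻¹ • ∑ x, ρ x)
      ≤ ∑ i, f i (QExtractor.substring y (S i) (hS.card_eq i)) (fun l => y l) := by
    intro y
    refine QExtractor.sum_traceNorm_sub_le (fun x => QExtractor.trevisan C S hS.card_eq x y)
      (fun x => (hpos x).isHermitian)
      (fun i => QExtractor.truthTables C S hS.card_eq i fun l => y l)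
      -- Only bits before `i` are compared, so the value `false` at the others is irrelevant.
      (fun i g j => if h : j < i then g ⟨j, h⟩ fun l => y l else false) ?_
    intro i x j hj
    simp only [hj, dif_pos]
    exact QExtractor.truthTables_apply C S hS.card_eq i y x ⟨j, hj⟩
  have hmain := (QExtractor.traceNorm_outputSeedSideState_sub_le
    (QExtractor.trevisan C S hS.card_eq) (fun x => (hpos x).isHermitian) hq.1).trans
    (Finset.sum_le_sum fun y _ => mul_le_mul_of_nonneg_left (hhyb y) (hq.1 y))
  have htotal : ∑ y, q y * ∑ i, f i (QExtractor.substring y (S i) (hS.card_eq i)) (fun l => y l)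
      ≤ m * (6 * Real.sqrt ε) := by
    simp only [Finset.mul_sum]
    rw [Finset.sum_comm]
    refine (Finset.sum_le_sum fun i _ => hseed i).trans_eq ?_
    simp
  -- The full trace norm is already at most 6m√ε; nonnegativity lets the factor 1/2 be dropped.
  have : 0 ≤ m * (6 * Real.sqrt ε) := by positivity
  linarith
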